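/- There are universal constants $c_2, C, K>0$ and $\alpha\in\mathbb{R}$ such that the following holds. Let $(\sigma_n)$ and $(B_n)$ be sequences of nonnegative reals with $B_n \ll \sigma_n\sqrt{n/\log^3 n}$, that is, $B_n = o\big(\sigma_n\sqrt{n/\log^3 n}\big)$ as $n\to\infty$. Then there is an $N$, depending only on the two sequences, such that for every $n\ge N$, every random matrix $\boldsymbol{H}\in\mathbb{R}^{n\times n}$ with independent (not necessarily identically distributed) entries satisfying, for all $1\le i,j\le n$, $$\mathbb{E} H_{ij}=0,\qquad \operatorname{Var}(H_{ij})\le\sigma_n^2,\qquad |H_{ij}|\le B_n \text{ almost surely},\qquad H_{ij}\overset{d}{=}-H_{ij},$$ and all fixed vectors $\boldsymbol{x},\boldsymbol{y}\in\mathbb{R}^n$ with $\|\boldsymbol{x}\|_2=\|\boldsymbol{y}\|_2=1$, with probability at least $1-K\,n^{-40}\log^{\alpha} n$ (that is, $1-\tilde O(n^{-40})$) the following bound holds simultaneously for all integers $k$ with $2\le k\le 20\log n$: $$\left|\boldsymbol{x}^\top\boldsymbol{H}^k\boldsymbol{y}-\mathbb{E}\,\boldsymbol{x}^\top\boldsymbol{H}^k\boldsymbol{y}\right|\le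 C\,c_2^k(\log n)^2\max\left\{\sqrt{\frac{(\sigma_n^2\,n\log^3 n)^k}{n}},\ (B_n\log^3 n)^k\,\|\boldsymbol{x}\|_\infty\|\boldsymbol{y}\|_\infty\right\}.$$ -/

import Mathlib

open MeasureTheory ProbabilityTheory Filter Asymptotics Matrix

/-- The random `n × n` real matrix `H` on the probability space `(Ω, P)` has independent entries
that are centred, have variance at most `σ ^ 2`, are bounded by `B` almost surely, and are
symmetrically distributed about `0`.  No symmetry of the matrix and no identical distribution
of the entries is required. -/
structure IsNoiseMatrix {Ω : Type*} [MeasurableSpace Ω] (P : Measure Ω) {n : ℕ}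
    (H : Ω → Matrix (Fin n) (Fin n) ℝ) (σ B : ℝ) : Prop where
  measurable : ∀ i j, Measurable (fun ω => H ω i j)
  indep : iIndepFun (fun (e : Fin n × Fin n) (ω : Ω) => H ω e.1 e.2) P
  mean_zero : ∀ i j, ∫ ω, H ω i j ∂P = 0
  variance_le : ∀ i j, variance (fun ω => H ω i j) P ≤ σ ^ 2
  bounded : ∀ i j, ∀ᵐ ω ∂P, |H ω i j| ≤ B
  symm_about_zero : ∀ i j, P.map (fun ω => H ω i j) = P.map (fun ω => -H ω i j)

/-- The bilinear form `xᵀ M y`. -/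
def bilin {n : ℕ} (M : Matrix (Fin n) (Fin n) ℝ) (x y : EuclideanSpace ℝ (Fin n)) : ℝ :=
  x.ofLp ⬝ᵥ (M *ᵥ y.ofLp)

/-- The maximum norm `max_i |x_i|`. -/
noncomputable def supNorm {n : ℕ} (x : EuclideanSpace ℝ (Fin n)) : ℝ := ⨆ i, |x i|

/-- A family of walks with `k` steps, indexed by `A`, in a directed multigraph with vertex set `Q`
and edge set `E`, such that every edge and every vertex lies on one of the walks. -/
structure WalkSystem (A E Q : Type*) (k : ℕ) where
  vertex : A → Fin (k + 1) → Q
  edge : A → Fin k → E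
  tail : E → Q
  head : E → Q
  tail_edge : ∀ a t, tail (edge a t) = vertex a t.castSucc
  head_edge : ∀ a t, head (edge a t) = vertex a t.succ
  edge_surj : ∀ e, ∃ a t, edge a t = e
  vertex_surj : ∀ q, ∃ a j, vertex a j = q

namespace WalkSystem

variable {A E Q : Type*} {k : ℕ} (W : WalkSystem A E Q k)

/-- The first vertex of a walk. -/
def start (a : A) : Q := W.vertex a 0

/-- The last vertex of a walk. -/
def finish (a : A) : Q := W.vertex a (Fin.last k)

/-- The coboundary of a function on the vertices. -/
def coboundary : (Q → ℚ) →ₗ[ℚ] (E → ℚ) where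
  toFun f e := f (W.head e) - f (W.tail e)
  map_add' f g := by ext e; simp only [Pi.add_apply]; ring
  map_smul' c f := by ext e; simp only [Pi.smul_apply, smul_eq_mul, RingHom.id_apply]; ring

lemma coboundary_apply (f : Q → ℚ) (e : E) :
    W.coboundary f e = f (W.head e) - f (W.tail e) := rfl

lemma coboundary_edge (f : Q → ℚ) (a : A) (t : Fin k) :
    W.coboundary f (W.edge a t) = f (W.vertex a t.succ) - f (W.vertex a t.castSucc) := by
  rw [coboundary_apply, W.head_edge, W.tail_edge]

lemma sum_coboundary (f : Q → ℚ) (a : A) :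
    ∑ t, W.coboundary f (W.edge a t) = f (W.finish a) - f (W.start a) := by
  simp only [coboundary_edge, Finset.sum_sub_distrib]
  have h1 := Fin.sum_univ_succ (fun j => f (W.vertex a j))
  have h2 := Fin.sum_univ_castSucc (fun j => f (W.vertex a j))
  simp only [finish, start]
  linarith

lemma eq_start_of_coboundary_eq_zero {f : Q → ℚ} (hf : W.coboundary f = 0) (a : A)
    (j : Fin (k + 1)) : f (W.vertex a j) = f (W.start a) := by
  induction j using Fin.induction with
  | zero => rfl
  | succ t ih =>
    have := congrFun hf (W.edge a t)
    rw [coboundary_edge, Pi.zero_apply] at this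
    linarith

/-- The number of times that a walk uses an edge. -/
noncomputable def mult [DecidableEq E] (a : A) (e : E) : ℚ :=
  ∑ t, if W.edge a t = e then 1 else 0

lemma sum_mult_mul [DecidableEq E] [Fintype E] (a : A) (u : E → ℚ) :
    ∑ e, W.mult a e * u e = ∑ t, u (W.edge a t) := by
  simp only [mult, Finset.sum_mul, ite_mul, one_mul, zero_mul]
  rw [Finset.sum_comm]
  simp

variable [Fintype A] [Fintype E] [Fintype Q] [DecidableEq A] [DecidableEq E] [DecidableEq Q]

set_option linter.unusedSectionVars false

/-- A set of walks whose multiplicity vectors form a basis of the span of all of them. -/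
lemma exists_basis : ∃ R : Finset A, LinearIndependent ℚ (fun a : R => W.mult (a : A)) ∧
    ∀ e, ∃ a ∈ R, ∃ t, W.edge a t = e := by
  obtain ⟨κ, g, hg, hspan, hli⟩ := exists_linearIndependent' ℚ W.mult
  classical
  have : Fintype κ := Fintype.ofInjective g hg
  refine ⟨Finset.univ.image g, ?_, ?_⟩
  · have hR : ∀ a : (Finset.univ.image g : Finset A), ∃ i, g i = a := fun a => by
      obtain ⟨i, -, h⟩ := Finset.mem_image.1 a.2
      exact ⟨i, h⟩
    choose i hi using hR
    have hinj : Function.Injective i := fun a b h => Subtype.ext (by rw [← hi a, ← hi b, h])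
    have := hli.comp i hinj
    simpa only [Function.comp_def, hi] using this
  · intro e
    by_contra! hcon
    obtain ⟨a, t, hat⟩ := W.edge_surj e
    have h0 : ∀ v ∈ Submodule.span ℚ (Set.range (W.mult ∘ g)), v e = 0 := by
      intro v hv
      induction hv using Submodule.span_induction with
      | mem v hv =>
        obtain ⟨i, rfl⟩ := hv
        simp only [Function.comp, mult]
        refine Finset.sum_eq_zero fun t _ => ?_
        rw [if_neg (hcon (g i) (by simp) t)]
      | zero => rfl
      | add v w _ _ hv hw => simp [hv, hw]
      | smul c v _ hv => simp [hv]
    have h1 := h0 (W.mult a) (by rw [hspan]; exact Submodule.subset_span ⟨a, rfl⟩)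
    have h2 : (1 : ℚ) ≤ W.mult a e := by
      unfold mult
      refine le_trans ?_ (Finset.single_le_sum (f := fun t => if W.edge a t = e then (1 : ℚ) else 0)
        (fun t _ => by positivity) (Finset.mem_univ t))
      simp [hat]
    linarith

lemma card_edge_le {R : Finset A} (hR : ∀ e, ∃ a ∈ R, ∃ t, W.edge a t = e) :
    Fintype.card E ≤ k * R.card := by
  choose a ha t ht using hR
  have : Function.Injective (fun e => ((⟨a e, ha e⟩, t e) : R × Fin k)) := by
    intro e e' h
    simp only [Prod.mk.injEq, Subtype.mk.injEq] at h
    rw [← ht e, ← ht e', h.1, h.2]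
  have := Fintype.card_le_of_injective _ this
  simpa [mul_comm] using this

lemma card_vertex_le (hk : 0 < k) {R : Finset A} (hR : ∀ e, ∃ a ∈ R, ∃ t, W.edge a t = e) :
    Fintype.card Q ≤ Fintype.card E + R.card := by
  let Φ : (Q → ℚ) →ₗ[ℚ] (E → ℚ) × (R → ℚ) :=
    W.coboundary.prod (LinearMap.funLeft ℚ ℚ fun a : R => W.start a)
  have hinj : Function.Injective Φ := by
    rw [← LinearMap.ker_eq_bot, LinearMap.ker_eq_bot']
    intro f hf
    have h1 : W.coboundary f = 0 := congrArg Prod.fst hf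
    have h2 : ∀ a ∈ R, f (W.start a) = 0 := fun a ha =>
      congrFun (congrArg Prod.snd hf) ⟨a, ha⟩
    ext q
    obtain ⟨a, j, rfl⟩ := W.vertex_surj q
    obtain ⟨a', ha', t, ht⟩ := hR (W.edge a ⟨0, hk⟩)
    rw [W.eq_start_of_coboundary_eq_zero h1,
      ← W.eq_start_of_coboundary_eq_zero h1 a (Fin.castSucc ⟨0, hk⟩), ← W.tail_edge, ← ht,
      W.tail_edge, W.eq_start_of_coboundary_eq_zero h1, h2 a' ha']
    rfl
  have := LinearMap.finrank_le_finrank_of_injective hinj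
  simpa using this

lemma card_vertex_add_le {R : Finset A} (hR : LinearIndependent ℚ (fun a : R => W.mult (a : A)))
    {S : Finset Q} (hstart : ∀ a, W.start a ∈ S) (hfinish : ∀ a, W.finish a ∈ S) :
    Fintype.card Q + R.card ≤ Fintype.card E + S.card := by
  let M : Matrix R E ℚ := fun a => W.mult a
  let Φ : (Q → ℚ) →ₗ[ℚ] (E → ℚ) × (S → ℚ) :=
    W.coboundary.prod (LinearMap.funLeft ℚ ℚ fun q : S => (q : Q))
  have hinj : Function.Injective Φ := by
    rw [← LinearMap.ker_eq_bot, LinearMap.ker_eq_bot']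
    intro f hf
    have h1 : W.coboundary f = 0 := congrArg Prod.fst hf
    have h2 : ∀ q ∈ S, f q = 0 := fun q hq => congrFun (congrArg Prod.snd hf) ⟨q, hq⟩
    ext q
    obtain ⟨a, j, rfl⟩ := W.vertex_surj q
    rw [W.eq_start_of_coboundary_eq_zero h1, h2 _ (hstart a)]
    rfl
  let N : (S → ℚ) →ₗ[ℚ] (R → ℚ) :=
    LinearMap.funLeft ℚ ℚ (fun a : R => (⟨W.finish a, hfinish a⟩ : S)) -
      LinearMap.funLeft ℚ ℚ (fun a : R => (⟨W.start a, hstart a⟩ : S))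
  let Ψ : (E → ℚ) × (S → ℚ) →ₗ[ℚ] (R → ℚ) := M.mulVecLin.coprod (-N)
  have hM : LinearMap.range M.mulVecLin = ⊤ := by
    apply Submodule.eq_top_of_finrank_eq
    have := LinearIndependent.rank_matrix (M := M) hR
    rw [Matrix.rank] at this
    simpa using this
  have hΨ : LinearMap.range Ψ = ⊤ := by
    rw [LinearMap.range_coprod, hM, top_sup_eq]
  have hle : LinearMap.range Φ ≤ LinearMap.ker Ψ := by
    rintro _ ⟨f, rfl⟩
    rw [LinearMap.mem_ker]
    ext a
    have h1 : (M *ᵥ W.coboundary f) a = f (W.finish a) - f (W.start a) := by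
      rw [← sum_coboundary, ← sum_mult_mul]; rfl
    simp [Ψ, Φ, N, LinearMap.funLeft_apply, h1]
  have h1 := LinearMap.finrank_range_add_finrank_ker Ψ
  have h2 := LinearMap.finrank_range_of_inj hinj
  have h3 := Submodule.finrank_mono hle
  rw [hΨ] at h1
  simp at h1 h2
  omega

/-- The number of walks that start at a vertex. -/
def startCount (q : Q) : ℕ := (Finset.univ.filter fun a => W.start a = q).card

/-- The number of walks that end at a vertex. -/
def finishCount (q : Q) : ℕ := (Finset.univ.filter fun a => W.finish a = q).card

lemma sum_startCount_mul (f : Q → ℚ) : ∑ q, (W.startCount q : ℚ) * f q = ∑ a, f (W.start a) := by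
  rw [← Finset.sum_fiberwise' Finset.univ W.start f]
  simp [startCount]

lemma sum_finishCount_mul (f : Q → ℚ) :
    ∑ q, (W.finishCount q : ℚ) * f q = ∑ a, f (W.finish a) := by
  rw [← Finset.sum_fiberwise' Finset.univ W.finish f]
  simp [finishCount]

/-- The number of steps, in all walks together, along an edge. -/
def edgeCount (e : E) : ℕ := (Finset.univ.filter fun s : A × Fin k => W.edge s.1 s.2 = e).card

lemma edgeCount_pos (e : E) : 0 < W.edgeCount e := by
  obtain ⟨a, t, h⟩ := W.edge_surj e
  exact Finset.card_pos.2 ⟨(a, t), by simp [h]⟩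

lemma sum_edgeCount_mul (f : E → ℚ) :
    ∑ e, (W.edgeCount e : ℚ) * f e = ∑ a, ∑ t, f (W.edge a t) := by
  rw [← Fintype.sum_prod_type' (f := fun a t => f (W.edge a t)),
    ← Finset.sum_fiberwise' Finset.univ (fun s : A × Fin k => W.edge s.1 s.2) f]
  simp [edgeCount]

lemma card_fiber_eq_sum (g : E → Q) (q : Q) :
    (Finset.univ.filter fun s : A × Fin k => g (W.edge s.1 s.2) = q).card =
      ∑ e with g e = q, W.edgeCount e := by
  rw [Finset.card_eq_sum_card_fiberwise (f := fun s : A × Fin k => W.edge s.1 s.2)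
    (t := Finset.univ.filter fun e => g e = q)]
  · refine Finset.sum_congr rfl fun e he => ?_
    rw [edgeCount, Finset.filter_filter]
    congr 1
    ext s
    simp only [Finset.mem_filter, Finset.mem_univ, true_and] at he ⊢
    constructor
    · exact fun h => h.2
    · exact fun h => ⟨by rw [h, he], h⟩
  · intro s hs
    simpa using hs

lemma even_startCount_add_finishCount (heven : ∀ e, Even (W.edgeCount e)) (q : Q) :
    Even (W.startCount q + W.finishCount q) := by
  have h1 : W.startCount q + ∑ e with W.head e = q, W.edgeCount e =
      ∑ a, ∑ j, if W.vertex a j = q then 1 else 0 := by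
    rw [← W.card_fiber_eq_sum, startCount, Finset.card_filter, Finset.card_filter,
      Fintype.sum_prod_type, ← Finset.sum_add_distrib]
    refine Finset.sum_congr rfl fun a _ => ?_
    rw [Fin.sum_univ_succ]
    simp only [W.head_edge]
    rfl
  have h2 : W.finishCount q + ∑ e with W.tail e = q, W.edgeCount e =
      ∑ a, ∑ j, if W.vertex a j = q then 1 else 0 := by
    rw [← W.card_fiber_eq_sum, finishCount, Finset.card_filter, Finset.card_filter,
      Fintype.sum_prod_type, ← Finset.sum_add_distrib]
    refine Finset.sum_congr rfl fun a _ => ?_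
    rw [Fin.sum_univ_castSucc, add_comm]
    simp only [W.tail_edge]
    rfl
  have h3 : Even (∑ e with W.head e = q, W.edgeCount e) := Finset.even_sum _ fun e _ => heven e
  have h4 : Even (∑ e with W.tail e = q, W.edgeCount e) := Finset.even_sum _ fun e _ => heven e
  rw [← h2] at h1
  have := congrArg Even h1
  simp only [Nat.even_add, h3, h4, iff_true, eq_iff_iff] at this ⊢
  exact this

/-- If every edge is used an even number of times, then the components in which no two walks start
at the same vertex contain a cycle. -/
lemma card_vertex_le_of_even (hk : 0 < k) (heven : ∀ e, Even (W.edgeCount e)) {X : Finset Q}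
    (hX : ∀ q, 2 ≤ W.startCount q → q ∈ X) :
    Fintype.card Q ≤ Fintype.card E + X.card := by
  let Φ : (Q → ℚ) →ₗ[ℚ] (E → ℚ) × (X → ℚ) :=
    W.coboundary.prod (LinearMap.funLeft ℚ ℚ fun q : X => (q : Q))
  obtain ⟨pr, hpr⟩ := (LinearMap.ker Φ).subtype.exists_leftInverse_of_injective
    (LinearMap.ker_eq_bot.2 (Submodule.subtype_injective _))
  let Θ : (Q → ℚ) →ₗ[ℚ] (E → ℚ) :=
    { toFun := fun g e => g (W.tail e) * W.edgeCount e
      map_add' := fun f g => by ext e; simp only [Pi.add_apply]; ring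
      map_smul' := fun c f => by
        ext e; simp only [Pi.smul_apply, smul_eq_mul, RingHom.id_apply]; ring }
  have horth : ∀ g ∈ LinearMap.ker Φ, ∀ f, ∑ e, Θ g e * W.coboundary f e = 0 := by
    intro g hg f
    rw [LinearMap.mem_ker] at hg
    have h1 : W.coboundary g = 0 := congrArg Prod.fst hg
    have h2 : ∀ q ∈ X, g q = 0 := fun q hq => congrFun (congrArg Prod.snd hg) ⟨q, hq⟩
    have h3 : ∑ e, Θ g e * W.coboundary f e =
        ∑ q, f q * (g q * ((W.finishCount q : ℚ) - W.startCount q)) := by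
      have : ∀ e, Θ g e * W.coboundary f e =
          (W.edgeCount e : ℚ) * (g (W.tail e) * W.coboundary f e) := by
        intro e
        change g (W.tail e) * W.edgeCount e * W.coboundary f e = _
        ring
      simp only [this]
      rw [sum_edgeCount_mul]
      have : ∀ a t, g (W.tail (W.edge a t)) * W.coboundary f (W.edge a t) =
          g (W.start a) * W.coboundary f (W.edge a t) := by
        intro a t
        rw [W.tail_edge, W.eq_start_of_coboundary_eq_zero h1]
      simp only [this, ← Finset.mul_sum, sum_coboundary]
      have h4 := W.sum_finishCount_mul (fun q => g q * f q)
      have h5 := W.sum_startCount_mul (fun q => g q * f q)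
      have h6 : ∀ a, g (W.finish a) = g (W.start a) := fun a =>
        W.eq_start_of_coboundary_eq_zero h1 a _
      simp only [h6] at h4
      simp only [mul_sub, Finset.sum_sub_distrib, ← h4, ← h5]
      congr 1 <;> exact Finset.sum_congr rfl fun q _ => by ring
    have h7 : ∑ q, g q ^ 2 * ((W.finishCount q : ℚ) - W.startCount q) = 0 := by
      have h4 := W.sum_finishCount_mul (fun q => g q ^ 2)
      have h5 := W.sum_startCount_mul (fun q => g q ^ 2)
      have h6 : ∀ a, g (W.finish a) = g (W.start a) := fun a =>
        W.eq_start_of_coboundary_eq_zero h1 a _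
      simp only [h6] at h4
      simp only [mul_sub, Finset.sum_sub_distrib]
      rw [sub_eq_zero, ← sub_eq_zero]
      simp only [mul_comm (_ ^ 2) _]
      rw [h4, h5, sub_self]
    have h8 : ∀ q, 0 ≤ g q ^ 2 * ((W.finishCount q : ℚ) - W.startCount q) := by
      intro q
      by_cases hq : q ∈ X
      · simp [h2 q hq]
      · have h9 : W.startCount q < 2 := by
          by_contra! h; exact hq (hX q h)
        have h10 := W.even_startCount_add_finishCount heven q
        have : W.startCount q ≤ W.finishCount q := by
          rcases Nat.lt_or_ge (W.finishCount q) (W.startCount q) with h | h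
          · have e1 : W.startCount q = 1 := by omega
            have e2 : W.finishCount q = 0 := by omega
            rw [e1, e2] at h10
            exact absurd h10 (by decide)
          · exact h
        have : (W.startCount q : ℚ) ≤ W.finishCount q := by exact_mod_cast this
        have := sub_nonneg.2 this
        positivity
    rw [h3]
    refine Finset.sum_eq_zero fun q _ => ?_
    have := (Finset.sum_eq_zero_iff_of_nonneg (fun q _ => h8 q)).1 h7 q (Finset.mem_univ q)
    rcases mul_eq_zero.1 this with h | h
    · rw [pow_eq_zero_iff two_ne_zero] at h
      simp [h]
    · simp [h]
  let Ξ : (Q → ℚ) →ₗ[ℚ] (E → ℚ) × (X → ℚ) :=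
    Φ + LinearMap.inl ℚ _ _ ∘ₗ Θ ∘ₗ (LinearMap.ker Φ).subtype ∘ₗ pr
  have hinj : Function.Injective Ξ := by
    rw [← LinearMap.ker_eq_bot, LinearMap.ker_eq_bot']
    intro f hf
    set g : Q → ℚ := (pr f).1 with hg
    have hgm : g ∈ LinearMap.ker Φ := (pr f).2
    have h1 : W.coboundary f + Θ g = 0 := congrArg Prod.fst hf
    have h2 : LinearMap.funLeft ℚ ℚ (fun q : X => (q : Q)) f + 0 = 0 := congrArg Prod.snd hf
    have h3 : ∑ e, Θ g e ^ 2 = 0 := by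
      have h4 := horth g hgm f
      have h5 : ∀ e, W.coboundary f e = -Θ g e := fun e => by
        have := congrFun h1 e
        rw [Pi.add_apply, Pi.zero_apply] at this
        linarith
      simp only [h5, mul_neg, Finset.sum_neg_distrib, neg_eq_zero] at h4
      rw [← h4]
      exact Finset.sum_congr rfl fun e _ => sq _
    have h4 : Θ g = 0 := by
      ext e
      have := (Finset.sum_eq_zero_iff_of_nonneg (fun e _ => sq_nonneg (Θ g e))).1 h3 e
        (Finset.mem_univ e)
      simpa using this
    have h5 : f ∈ LinearMap.ker Φ := by
      rw [LinearMap.mem_ker]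
      refine Prod.ext ?_ ?_
      · change W.coboundary f = 0
        rw [← h1, h4, add_zero]
      · change LinearMap.funLeft ℚ ℚ (fun q : X => (q : Q)) f = 0
        rw [← h2, add_zero]
    have h6 : g = f := by
      have := LinearMap.congr_fun hpr ⟨f, h5⟩
      exact congrArg Subtype.val this
    have h7 : W.coboundary f = 0 := by rw [← h1, h4, add_zero]
    ext q
    obtain ⟨a, j, rfl⟩ := W.vertex_surj q
    have h8 : Θ g (W.edge a ⟨0, hk⟩) = 0 := by rw [h4]; rfl
    change g (W.tail _) * (W.edgeCount _ : ℚ) = 0 at h8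
    rw [h6, W.tail_edge] at h8
    have h9 := (mul_eq_zero.1 h8).resolve_right (by exact_mod_cast (W.edgeCount_pos _).ne')
    rw [W.eq_start_of_coboundary_eq_zero h7] at h9 ⊢
    exact h9
  have := LinearMap.finrank_le_finrank_of_injective hinj
  simpa using this

end WalkSystem

section Weights

variable {ι : Type*} [Fintype ι] {x y : ι → ℝ} {a b : ℝ}

lemma sum_mul_le_one (hx : ∑ i, x i ^ 2 ≤ 1) (hy : ∑ i, y i ^ 2 ≤ 1) : ∑ i, x i * y i ≤ 1 := by
  have : ∑ i, x i * y i ≤ ∑ i, (x i ^ 2 + y i ^ 2) / 2 :=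
    Finset.sum_le_sum fun i _ => by nlinarith [sq_nonneg (x i - y i)]
  rw [← Finset.sum_div, Finset.sum_add_distrib] at this
  linarith

lemma sum_pow_mul_pow_le_of_two_le (hx0 : ∀ i, 0 ≤ x i) (hy0 : ∀ i, 0 ≤ y i)
    (hx : ∑ i, x i ^ 2 ≤ 1) (hxa : ∀ i, x i ≤ a) (hyb : ∀ i, y i ≤ b) (ha : 0 ≤ a) (hb : 0 ≤ b)
    {m l : ℕ} (hm : 2 ≤ m) : ∑ i, x i ^ m * y i ^ l ≤ a ^ (m - 2) * b ^ l := by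
  obtain ⟨m, rfl⟩ := Nat.exists_eq_add_of_le' hm
  calc ∑ i, x i ^ (m + 2) * y i ^ l ≤ ∑ i, a ^ m * b ^ l * x i ^ 2 := by
        refine Finset.sum_le_sum fun i _ => ?_
        have h1 : x i ^ m ≤ a ^ m := pow_le_pow_left₀ (hx0 i) (hxa i) m
        have h2 : y i ^ l ≤ b ^ l := pow_le_pow_left₀ (hy0 i) (hyb i) l
        have := mul_le_mul h1 h2 (pow_nonneg (hy0 i) l) (pow_nonneg ha m)
        calc x i ^ (m + 2) * y i ^ l = x i ^ m * y i ^ l * x i ^ 2 := by ring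
          _ ≤ _ := mul_le_mul_of_nonneg_right this (sq_nonneg _)
    _ = a ^ m * b ^ l * ∑ i, x i ^ 2 := by rw [Finset.mul_sum]
    _ ≤ a ^ m * b ^ l * 1 := by gcongr
    _ = _ := by simp

lemma sum_mul_pow_le (hx0 : ∀ i, 0 ≤ x i) (hy0 : ∀ i, 0 ≤ y i)
    (hx : ∑ i, x i ^ 2 ≤ 1) (hy : ∑ i, y i ^ 2 ≤ 1) (hyb : ∀ i, y i ≤ b) (hb : 0 ≤ b) (l : ℕ) :
    ∑ i, x i * y i ^ (l + 1) ≤ b ^ l := by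
  calc ∑ i, x i * y i ^ (l + 1) ≤ ∑ i, b ^ l * (x i * y i) := by
        refine Finset.sum_le_sum fun i _ => ?_
        have h2 : y i ^ l ≤ b ^ l := pow_le_pow_left₀ (hy0 i) (hyb i) l
        calc x i * y i ^ (l + 1) = y i ^ l * (x i * y i) := by ring
          _ ≤ _ := mul_le_mul_of_nonneg_right h2 (mul_nonneg (hx0 i) (hy0 i))
    _ = b ^ l * ∑ i, x i * y i := by rw [Finset.mul_sum]
    _ ≤ b ^ l * 1 := by gcongr; exact sum_mul_le_one hx hy
    _ = _ := by simp

lemma sum_pow_mul_pow_le_one (hx0 : ∀ i, 0 ≤ x i) (hy0 : ∀ i, 0 ≤ y i)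
    (hx : ∑ i, x i ^ 2 ≤ 1) (hy : ∑ i, y i ^ 2 ≤ 1) (hx1 : ∀ i, x i ≤ 1) (hy1 : ∀ i, y i ≤ 1)
    {m l : ℕ} (h : 2 ≤ m + l) : ∑ i, x i ^ m * y i ^ l ≤ 1 := by
  rcases Nat.lt_or_ge m 2 with hm | hm
  · interval_cases m
    · have := sum_pow_mul_pow_le_of_two_le hy0 hx0 hy hy1 hx1 zero_le_one zero_le_one
        (m := l) (l := 0) (by omega)
      simpa using this
    · obtain ⟨l, rfl⟩ := Nat.exists_eq_add_of_le' (show 1 ≤ l by omega)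
      simpa using sum_mul_pow_le hx0 hy0 hx hy hy1 zero_le_one l
  · simpa using sum_pow_mul_pow_le_of_two_le hx0 hy0 hx hx1 hy1 zero_le_one zero_le_one
      (l := l) hm

lemma sum_pow_mul_pow_le_of_lt_two (hx0 : ∀ i, 0 ≤ x i) (hy0 : ∀ i, 0 ≤ y i)
    (hx : ∑ i, x i ^ 2 ≤ 1) (hy : ∑ i, y i ^ 2 ≤ 1) (hxa : ∀ i, x i ≤ a) (hyb : ∀ i, y i ≤ b)
    (hb : 0 < b) (hba : b ≤ a) {m l : ℕ} (hm : m < 2) (heven : Even (m + l)) (h0 : m + l ≠ 0) :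
    ∑ i, x i ^ m * y i ^ l ≤ a ^ m * b ^ l * (b ^ 2)⁻¹ := by
  interval_cases m
  · have h2 : 2 ≤ l := by
      obtain ⟨c, hc⟩ := heven
      omega
    have := sum_pow_mul_pow_le_of_two_le hy0 hx0 hy hyb hxa hb.le (hb.le.trans hba)
        (m := l) (l := 0) h2
    obtain ⟨l, rfl⟩ := Nat.exists_eq_add_of_le' h2
    have h3 : a ^ 0 * b ^ (l + 2) * (b ^ 2)⁻¹ = b ^ l := by
      rw [pow_add]; field_simp
    rw [h3]
    simpa using this
  · obtain ⟨l, rfl⟩ : ∃ c, l = c + 1 := by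
      obtain ⟨c, hc⟩ := heven
      exact ⟨l - 1, by omega⟩
    have h3 : a ^ 1 * b ^ (l + 1) * (b ^ 2)⁻¹ = b ^ l * (a / b) := by
      rw [pow_add]; field_simp
    rw [h3]
    have := sum_mul_pow_le hx0 hy0 hx hy hyb hb.le l
    have h4 : 1 ≤ a / b := by rwa [one_le_div hb]
    have h5 : b ^ l ≤ b ^ l * (a / b) := le_mul_of_one_le_right (by positivity) h4
    simpa using this.trans h5

lemma pow_mul_pow_mul_pow_le {A B N : ℝ} (hA : 1 ≤ A) (hAB : A ≤ B) (hBN : B ≤ N)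
    {d r e₀ e₁ e₂ : ℕ} (h0 : e₀ + r ≤ d) (h1 : e₀ + e₁ ≤ d) (h2 : e₀ + e₁ + e₂ ≤ d + r) :
    N ^ e₀ * B ^ e₁ * A ^ e₂ ≤ N ^ (d - r) * (A * B) ^ r := by
  have hB : 1 ≤ B := hA.trans hAB
  have hN : 1 ≤ N := hB.trans hBN
  obtain ⟨f, hf⟩ : ∃ f, d - r = e₀ + f := ⟨d - r - e₀, by omega⟩
  rw [hf, pow_add, mul_assoc, mul_assoc]
  refine mul_le_mul_of_nonneg_left ?_ (by positivity)
  rw [mul_pow]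
  rcases Nat.lt_or_ge e₁ r with h | h
  · obtain ⟨g, rfl⟩ : ∃ g, r = e₁ + g := ⟨r - e₁, by omega⟩
    calc B ^ e₁ * A ^ e₂ ≤ B ^ e₁ * A ^ (f + (e₁ + g) + g) := by
          gcongr
          all_goals first | exact hA | omega
      _ = B ^ e₁ * (A ^ f * A ^ (e₁ + g) * A ^ g) := by rw [pow_add, pow_add A f]
      _ ≤ B ^ e₁ * (N ^ f * A ^ (e₁ + g) * B ^ g) := by
          gcongr
          exact hAB.trans hBN
      _ = _ := by ring
  · obtain ⟨g, rfl⟩ : ∃ g, e₁ = r + g := ⟨e₁ - r, by omega⟩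
    obtain ⟨j, rfl⟩ : ∃ j, f = g + j := ⟨f - g, by omega⟩
    calc B ^ (r + g) * A ^ e₂ ≤ B ^ (r + g) * A ^ (j + r) := by
          gcongr
          all_goals first | exact hA | omega
      _ = B ^ r * B ^ g * (A ^ j * A ^ r) := by rw [pow_add, pow_add]
      _ ≤ B ^ r * N ^ g * (N ^ j * A ^ r) := by
          gcongr
          exact hAB.trans hBN
      _ = _ := by ring

end Weights

namespace WalkSystem

variable {A E Q : Type*} {k : ℕ} (W : WalkSystem A E Q k)
variable [Fintype A] [Fintype E] [Fintype Q] [DecidableEq A] [DecidableEq E] [DecidableEq Q]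
set_option linter.unusedSectionVars false

lemma prod_pow_startCount {M : Type*} [CommMonoid M] (f : Q → M) :
    ∏ q, f q ^ W.startCount q = ∏ a, f (W.start a) := by
  rw [← Finset.prod_fiberwise' Finset.univ W.start f]
  simp [startCount]

lemma prod_pow_finishCount {M : Type*} [CommMonoid M] (f : Q → M) :
    ∏ q, f q ^ W.finishCount q = ∏ a, f (W.finish a) := by
  rw [← Finset.prod_fiberwise' Finset.univ W.finish f]
  simp [finishCount]

lemma sum_weight_eq {ι : Type*} [Fintype ι] (x y : ι → ℝ) :
    ∑ u : Q → ι, ∏ a, x (u (W.start a)) * y (u (W.finish a)) =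
      ∏ q, ∑ i, x i ^ W.startCount q * y i ^ W.finishCount q := by
  classical
  rw [Finset.prod_univ_sum, Fintype.piFinset_univ]
  refine Finset.sum_congr rfl fun u _ => ?_
  rw [Finset.prod_mul_distrib, Finset.prod_mul_distrib,
    W.prod_pow_startCount (fun q => x (u q)), W.prod_pow_finishCount (fun q => y (u q))]

/-- The total weight of the labellings of the vertices, where each walk has a weight that depends
on its end points, in terms of the rank `r` of the system of walks. -/
theorem sum_weight_le {ι : Type*} [Fintype ι] {x y : ι → ℝ} {a b : ℝ}
    (hk : 0 < k) (heven : ∀ e, Even (W.edgeCount e))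
    (hx0 : ∀ i, 0 ≤ x i) (hy0 : ∀ i, 0 ≤ y i)
    (hx : ∑ i, x i ^ 2 ≤ 1) (hy : ∑ i, y i ^ 2 ≤ 1) (hxa : ∀ i, x i ≤ a) (hyb : ∀ i, y i ≤ b)
    (hb : 0 < b) (hba : b ≤ a) (ha : a ≤ 1) (hnb : 1 ≤ Fintype.card ι * b ^ 2) :
    ∃ r, Fintype.card E ≤ k * r ∧ r ≤ Fintype.card E ∧
      ∑ u : Q → ι, ∏ a, x (u (W.start a)) * y (u (W.finish a)) ≤
        (Fintype.card ι : ℝ) ^ (Fintype.card E - r) ∧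
      (2 * r ≤ Fintype.card A →
        ∑ u : Q → ι, ∏ a, x (u (W.start a)) * y (u (W.finish a)) ≤
          (Fintype.card ι : ℝ) ^ (Fintype.card E - r) * (a * b) ^ (Fintype.card A - 2 * r)) := by
  obtain ⟨R, hli, hcov⟩ := W.exists_basis
  set N : ℝ := (Fintype.card ι : ℝ) with hNdef
  have ha0 : 0 < a := hb.trans_le hba
  have hN1 : 1 ≤ N := hnb.trans (mul_le_of_le_one_right (by positivity)
    (pow_le_one₀ hb.le (hba.trans ha)))
  set S : Finset Q := Finset.univ.filter fun q => W.startCount q + W.finishCount q ≠ 0 with hS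
  set X : Finset Q := Finset.univ.filter fun q => 2 ≤ W.startCount q with hX
  have hXS : X ⊆ S := by
    intro q
    simp only [hX, hS, Finset.mem_filter, Finset.mem_univ, true_and]
    omega
  have hstart : ∀ a, W.start a ∈ S := by
    intro a
    have : 0 < W.startCount (W.start a) := Finset.card_pos.2 ⟨a, by simp⟩
    simp only [hS, Finset.mem_filter, Finset.mem_univ, true_and]
    omega
  have hfinish : ∀ a, W.finish a ∈ S := by
    intro a
    have : 0 < W.finishCount (W.finish a) := Finset.card_pos.2 ⟨a, by simp⟩
    simp only [hS, Finset.mem_filter, Finset.mem_univ, true_and]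
    omega
  have h1 := W.card_vertex_add_le hli hstart hfinish
  have h2 := W.card_vertex_le_of_even hk heven (X := X) (fun q hq => by simpa [hX] using hq)
  have h3 := W.card_vertex_le hk hcov
  have hSQ : S.card ≤ Fintype.card Q := Finset.card_le_univ S
  have hXS' : X.card ≤ S.card := Finset.card_le_card hXS
  have hS2 : ∀ q ∈ S, 2 ≤ W.startCount q + W.finishCount q := by
    intro q hq
    simp only [hS, Finset.mem_filter, Finset.mem_univ, true_and] at hq
    obtain ⟨c, hc⟩ := W.even_startCount_add_finishCount heven q
    omega
  have hnS : ∀ q ∉ S, ∑ i, x i ^ W.startCount q * y i ^ W.finishCount q = N := by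
    intro q hq
    simp only [hS, Finset.mem_filter, Finset.mem_univ, true_and, not_not, Nat.add_eq_zero_iff]
      at hq
    simp [hq.1, hq.2, hNdef]
  have hnonneg : ∀ q, 0 ≤ ∑ i, x i ^ W.startCount q * y i ^ W.finishCount q := fun q =>
    Finset.sum_nonneg fun i _ => mul_nonneg (pow_nonneg (hx0 i) _) (pow_nonneg (hy0 i) _)
  have hcardc : (Finset.univ \ S).card = Fintype.card Q - S.card := by
    rw [Finset.card_sdiff_of_subset (Finset.subset_univ S), Finset.card_univ]
  refine ⟨R.card, W.card_edge_le hcov, by omega, ?_, fun h2r => ?_⟩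
  · rw [sum_weight_eq]
    calc ∏ q, ∑ i, x i ^ W.startCount q * y i ^ W.finishCount q
        ≤ ∏ q, if q ∈ S then 1 else N := by
          refine Finset.prod_le_prod (fun q _ => hnonneg q) fun q _ => ?_
          split_ifs with hq
          · exact sum_pow_mul_pow_le_one hx0 hy0 hx hy (fun i => (hxa i).trans ha)
              (fun i => (hyb i).trans (hba.trans ha)) (hS2 q hq)
          · exact (hnS q hq).le
      _ = N ^ (Fintype.card Q - S.card) := by
          rw [← hcardc, Finset.prod_ite]
          simp [Finset.filter_notMem_eq_sdiff]
      _ ≤ N ^ (Fintype.card E - R.card) := pow_le_pow_right₀ hN1 (by omega)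
  · rw [sum_weight_eq]
    calc ∏ q, ∑ i, x i ^ W.startCount q * y i ^ W.finishCount q
        ≤ ∏ q, a ^ W.startCount q * b ^ W.finishCount q *
            (if q ∈ S then (if q ∈ X then (a ^ 2)⁻¹ else (b ^ 2)⁻¹) else N) := by
          refine Finset.prod_le_prod (fun q _ => hnonneg q) fun q _ => ?_
          split_ifs with hq hq'
          · have hm : 2 ≤ W.startCount q := by simpa [hX] using hq'
            refine (sum_pow_mul_pow_le_of_two_le hx0 hy0 hx hxa hyb ha0.le hb.le hm).trans_eq ?_
            obtain ⟨c, hc⟩ := Nat.exists_eq_add_of_le' hm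
            rw [hc]
            simp only [Nat.add_sub_cancel, pow_add]
            field_simp
          · have hm : W.startCount q < 2 := by simpa [hX] using hq'
            exact sum_pow_mul_pow_le_of_lt_two hx0 hy0 hx hy hxa hyb hb hba hm
              (W.even_startCount_add_finishCount heven q) (by have := hS2 q hq; omega)
          · rw [hnS q hq]
            simp only [hS, Finset.mem_filter, Finset.mem_univ, true_and, not_not,
              Nat.add_eq_zero_iff] at hq
            simp [hq.1, hq.2]
      _ = (a * b) ^ Fintype.card A * (N ^ (Fintype.card Q - S.card) *
            ((b ^ 2)⁻¹) ^ (S.card - X.card) * ((a ^ 2)⁻¹) ^ X.card) := by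
          rw [Finset.prod_mul_distrib, Finset.prod_mul_distrib,
            W.prod_pow_startCount (fun _ => a), W.prod_pow_finishCount (fun _ => b)]
          congr 1
          · simp [mul_pow]
          · rw [← hcardc, ← Finset.card_sdiff_of_subset hXS, Finset.prod_ite, Finset.prod_ite]
            simp only [Finset.prod_const]
            have e1 : (Finset.univ.filter fun q => q ∈ S).filter (fun q => q ∈ X) = X := by
              ext q; simp only [Finset.mem_filter, Finset.mem_univ, true_and]
              exact ⟨fun h => h.2, fun h => ⟨hXS h, h⟩⟩
            have e2 : (Finset.univ.filter fun q => q ∈ S).filter (fun q => q ∉ X) = S \ X := by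
              ext q; simp
            have e3 : (Finset.univ.filter fun q => q ∉ S) = Finset.univ \ S := by
              ext q; simp
            rw [e1, e2, e3]
            ring
      _ ≤ (a * b) ^ Fintype.card A * (N ^ (Fintype.card E - R.card) *
            ((a ^ 2)⁻¹ * (b ^ 2)⁻¹) ^ R.card) := by
          refine mul_le_mul_of_nonneg_left ?_ (by positivity)
          refine pow_mul_pow_mul_pow_le ?_ ?_ ?_ (by omega) (by omega) (by omega)
          · exact (one_le_inv₀ (by positivity)).2 (pow_le_one₀ ha0.le ha)
          · exact inv_anti₀ (by positivity) (pow_le_pow_left₀ hb.le hba 2)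
          · rw [inv_le_iff_one_le_mul₀ (by positivity)]
            exact hnb
      _ = N ^ (Fintype.card E - R.card) * (a * b) ^ (Fintype.card A - 2 * R.card) := by
          obtain ⟨c, hc⟩ := Nat.exists_eq_add_of_le h2r
          rw [hc, Nat.add_sub_cancel_left, ← mul_inv, ← mul_pow, pow_add, pow_mul, inv_pow]
          field_simp

/-- The contribution of one system of walks to the moment bound. -/
theorem moment_weight_le {ι : Type*} [Fintype ι] {x y : ι → ℝ} {a b σ B : ℝ}
    (hk : 0 < k) (heven : ∀ e, Even (W.edgeCount e)) (hA : Even (Fintype.card A))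
    (hx0 : ∀ i, 0 ≤ x i) (hy0 : ∀ i, 0 ≤ y i)
    (hx : ∑ i, x i ^ 2 ≤ 1) (hy : ∑ i, y i ^ 2 ≤ 1) (hxa : ∀ i, x i ≤ a) (hyb : ∀ i, y i ≤ b)
    (hb : 0 < b) (hba : b ≤ a) (ha : a ≤ 1) (hnb : 1 ≤ Fintype.card ι * b ^ 2)
    (hσ : 0 ≤ σ) (hB : 0 ≤ B) (hBσ : B ≤ σ * √(Fintype.card ι)) :
    (σ ^ 2) ^ Fintype.card E * B ^ (Fintype.card A * k - 2 * Fintype.card E) *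
      ∑ u : Q → ι, ∏ a, x (u (W.start a)) * y (u (W.finish a)) ≤
      max ((σ * √(Fintype.card ι)) ^ k / √(Fintype.card ι)) (B ^ k * (a * b)) ^
        Fintype.card A := by
  obtain ⟨r, hr1, hr2, hr3, hr4⟩ := W.sum_weight_le hk heven hx0 hy0 hx hy hxa hyb hb hba ha hnb
  have ha0 : 0 < a := hb.trans_le hba
  have hE : 2 * Fintype.card E ≤ Fintype.card A * k := by
    have h1 : ∀ e, 2 ≤ W.edgeCount e := fun e => by
      obtain ⟨c, hc⟩ := heven e
      have := W.edgeCount_pos e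
      omega
    have h2 : ∑ e, W.edgeCount e = Fintype.card A * k := by
      have := Finset.card_eq_sum_card_fiberwise (s := (Finset.univ : Finset (A × Fin k)))
        (f := fun s : A × Fin k => W.edge s.1 s.2) (t := Finset.univ) (fun _ _ => by simp)
      simpa [edgeCount] using this.symm
    calc 2 * Fintype.card E = ∑ e : E, 2 := by simp [mul_comm]
      _ ≤ _ := (Finset.sum_le_sum fun e _ => h1 e).trans_eq h2
  set D := Fintype.card E
  set p := Fintype.card A
  set N : ℝ := (Fintype.card ι : ℝ) with hNdef
  set w := ∑ u : Q → ι, ∏ a, x (u (W.start a)) * y (u (W.finish a))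
  have hN1 : 1 ≤ N := hnb.trans (mul_le_of_le_one_right (by positivity)
    (pow_le_one₀ hb.le (hba.trans ha)))
  have hN0 : 0 < N := zero_lt_one.trans_le hN1
  have hw : 0 ≤ w := Finset.sum_nonneg fun u _ => Finset.prod_nonneg fun a _ =>
    mul_nonneg (hx0 _) (hy0 _)
  have hs : (σ * √N) ^ 2 = σ ^ 2 * N := by rw [mul_pow, Real.sq_sqrt hN0.le]
  set s := σ * √N with hsdef
  have hs0 : 0 ≤ s := by positivity
  have key : (σ ^ 2) ^ D * N ^ D = s ^ (2 * D) := by rw [← mul_pow, ← hs, pow_mul]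
  obtain ⟨m, hm⟩ := hA
  rcases Nat.lt_or_ge (2 * r) p with h | h
  · calc (σ ^ 2) ^ D * B ^ (p * k - 2 * D) * w
        ≤ (σ ^ 2) ^ D * B ^ (p * k - 2 * D) * (N ^ (D - r) * (a * b) ^ (p - 2 * r)) := by
          gcongr
          exact hr4 h.le
      _ = s ^ (2 * D) * B ^ (p * k - 2 * D) * ((a * b) ^ (p - 2 * r) / N ^ r) := by
          rw [← key, pow_sub₀ _ hN0.ne' hr2]
          field_simp
      _ ≤ s ^ (2 * (k * r)) * B ^ (k * (p - 2 * r)) * ((a * b) ^ (p - 2 * r) / N ^ r) := by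
          refine mul_le_mul_of_nonneg_right ?_ (by positivity)
          obtain ⟨c, hc⟩ := Nat.exists_eq_add_of_le hr1
          obtain ⟨l, hl⟩ := Nat.exists_eq_add_of_le h.le
          have e1 : p * k - 2 * D = 2 * c + k * l := by
            rw [hl]
            have : (2 * r + l) * k = 2 * (k * r) + k * l := by ring
            omega
          rw [hc, e1, hl, Nat.add_sub_cancel_left]
          calc s ^ (2 * D) * B ^ (2 * c + k * l) = s ^ (2 * D) * (B ^ (2 * c) * B ^ (k * l)) := by
                rw [pow_add]
            _ ≤ s ^ (2 * D) * (s ^ (2 * c) * B ^ (k * l)) := by gcongr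
            _ = _ := by rw [mul_add, pow_add]; ring
      _ = (s ^ k / √N) ^ (2 * r) * (B ^ k * (a * b)) ^ (p - 2 * r) := by
          rw [div_pow, pow_mul (√N), Real.sq_sqrt hN0.le, mul_pow (B ^ k), ← pow_mul, ← pow_mul]
          have : 2 * (k * r) = k * (2 * r) := by ring
          rw [this]
          ring
      _ ≤ max (s ^ k / √N) (B ^ k * (a * b)) ^ (2 * r) *
            max (s ^ k / √N) (B ^ k * (a * b)) ^ (p - 2 * r) := by
          gcongr
          · exact le_max_left _ _
          · exact le_max_right _ _
      _ = _ := by rw [← pow_add]; congr 1; omega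
  · calc (σ ^ 2) ^ D * B ^ (p * k - 2 * D) * w
        ≤ (σ ^ 2) ^ D * s ^ (p * k - 2 * D) * N ^ (D - m) := by
          have := hr3.trans (pow_le_pow_right₀ hN1 (show D - r ≤ D - m by omega))
          gcongr
      _ = s ^ (2 * D) * s ^ (p * k - 2 * D) / N ^ m := by
          rw [← key, pow_sub₀ _ hN0.ne' (by omega)]
          field_simp
      _ = (s ^ k / √N) ^ p := by
          rw [← pow_add, div_pow, ← pow_mul]
          congr 1
          · congr 1
            rw [Nat.add_sub_cancel' hE, mul_comm]
          · rw [hm, ← two_mul, pow_mul, Real.sq_sqrt hN0.le]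
      _ ≤ _ := by
          gcongr
          exact le_max_left _ _

end WalkSystem

/-- The bilinear form of a matrix power as a sum over walks. -/
lemma dotProduct_pow_mulVec {n : ℕ} (M : Matrix (Fin n) (Fin n) ℝ) (k : ℕ) (x y : Fin n → ℝ) :
    x ⬝ᵥ (M ^ k *ᵥ y) = ∑ w : Fin (k + 1) → Fin n,
      x (w 0) * y (w (Fin.last k)) * ∏ t : Fin k, M (w t.castSucc) (w t.succ) := by
  induction k generalizing x with
  | zero =>
    rw [pow_zero, one_mulVec, dotProduct, ← (Equiv.funUnique (Fin 1) (Fin n)).symm.sum_comp]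
    simp [Equiv.funUnique]
  | succ k ih =>
    rw [pow_succ', ← mulVec_mulVec, dotProduct_mulVec, ih,
      ← (Fin.consEquiv fun _ : Fin (k + 2) => Fin n).sum_comp, Fintype.sum_prod_type_right]
    refine Finset.sum_congr rfl fun w _ => ?_
    simp only [vecMul, dotProduct, Finset.sum_mul, Fin.consEquiv_apply]
    refine Finset.sum_congr rfl fun i _ => ?_
    rw [Fin.prod_univ_succ]
    simp only [Fin.cons_zero, Fin.castSucc_zero, Fin.cons_succ, ← Fin.succ_last,
      ← Fin.succ_castSucc]
    ring

section Pattern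

variable {p k n : ℕ}

/-- The steps of a family of walks, as pairs of consecutive vertices. -/
def stepEdge (v : Fin p → Fin (k + 1) → Fin n) (s : Fin p × Fin k) : Fin n × Fin n :=
  (v s.1 s.2.castSucc, v s.1 s.2.succ)

lemma pow_dotProduct_pow_mulVec (M : Matrix (Fin n) (Fin n) ℝ) (p k : ℕ) (x y : Fin n → ℝ) :
    (x ⬝ᵥ (M ^ k *ᵥ y)) ^ p = ∑ v : Fin p → Fin (k + 1) → Fin n,
      (∏ a, x (v a 0) * y (v a (Fin.last k))) *
        ∏ s, M (stepEdge v s).1 (stepEdge v s).2 := by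
  rw [dotProduct_pow_mulVec, Fintype.sum_pow]
  refine Finset.sum_congr rfl fun v _ => ?_
  rw [Finset.prod_mul_distrib, Fintype.prod_prod_type]
  rfl

/-- The identifications of vertices that are forced if the steps with the same image under `π`
are to be along the same edge. -/
def patternRel (π : Fin p × Fin k → Fin p × Fin k) (i j : Fin p × Fin (k + 1)) : Prop :=
  ∃ s s', π s = π s' ∧ ((i = (s.1, s.2.castSucc) ∧ j = (s'.1, s'.2.castSucc)) ∨
    (i = (s.1, s.2.succ) ∧ j = (s'.1, s'.2.succ)))

/-- The universal family of walks in which the steps with the same image under `π` are along the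
same edge. -/
noncomputable def WalkSystem.ofPattern (π : Fin p × Fin k → Fin p × Fin k) :
    WalkSystem (Fin p) (Set.range π) (Quot (patternRel π)) k where
  vertex a j := Quot.mk _ (a, j)
  edge a t := ⟨π (a, t), (a, t), rfl⟩
  tail e := Quot.mk _ (e.2.choose.1, e.2.choose.2.castSucc)
  head e := Quot.mk _ (e.2.choose.1, e.2.choose.2.succ)
  tail_edge a t := by
    refine Quot.sound ⟨_, (a, t), ?_, Or.inl ⟨rfl, rfl⟩⟩
    exact Exists.choose_spec (p := fun s => π s = π (a, t)) ⟨(a, t), rfl⟩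
  head_edge a t := by
    refine Quot.sound ⟨_, (a, t), ?_, Or.inr ⟨rfl, rfl⟩⟩
    exact Exists.choose_spec (p := fun s => π s = π (a, t)) ⟨(a, t), rfl⟩
  edge_surj := by
    rintro ⟨_, s, rfl⟩
    exact ⟨s.1, s.2, rfl⟩
  vertex_surj q := by
    induction q using Quot.ind with
    | mk i => exact ⟨i.1, i.2, rfl⟩

/-- The walks `v` have coinciding steps exactly where `π` prescribes it. -/
def HasPattern (π : Fin p × Fin k → Fin p × Fin k) (v : Fin p → Fin (k + 1) → Fin n) : Prop :=
  ∀ s s', π s = π s' ↔ stepEdge v s = stepEdge v s'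

lemma exists_hasPattern (v : Fin p → Fin (k + 1) → Fin n) : ∃ π, HasPattern π v := by
  classical
  refine ⟨fun s => Exists.choose (p := fun s' => stepEdge v s' = stepEdge v s) ⟨s, rfl⟩,
    fun s s' => ⟨fun h => ?_, fun h => ?_⟩⟩
  · have h1 := Exists.choose_spec (p := fun s' => stepEdge v s' = stepEdge v s) ⟨s, rfl⟩
    have h2 := Exists.choose_spec (p := fun s'' => stepEdge v s'' = stepEdge v s') ⟨s', rfl⟩
    dsimp only at h
    rw [← h1, ← h2, h]
  · simp only [h]

lemma HasPattern.exists_lift {π : Fin p × Fin k → Fin p × Fin k}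
    {v : Fin p → Fin (k + 1) → Fin n} (h : HasPattern π v) :
    ∃ u : Quot (patternRel π) → Fin n, v = fun a j => u (Quot.mk _ (a, j)) := by
  refine ⟨Quot.lift (fun i => v i.1 i.2) ?_, rfl⟩
  rintro i j ⟨s, s', hs, ⟨rfl, rfl⟩ | ⟨rfl, rfl⟩⟩
  · exact congrArg Prod.fst ((h s s').1 hs)
  · exact congrArg Prod.snd ((h s s').1 hs)

/-- The number of steps along a given edge. -/
def stepCount (v : Fin p → Fin (k + 1) → Fin n) (e : Fin n × Fin n) : ℕ :=
  (Finset.univ.filter fun s => stepEdge v s = e).card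

/-- A bound for the expected product of the entries along the steps of the walks. -/
noncomputable def stepWeight (σ B : ℝ) (v : Fin p → Fin (k + 1) → Fin n) : ℝ :=
  open Classical in
  if ∀ e, Even (stepCount v e) then
    (σ ^ 2) ^ (Finset.univ.image (stepEdge v)).card *
      B ^ (p * k - 2 * (Finset.univ.image (stepEdge v)).card)
  else 0

lemma stepWeight_nonneg {σ B : ℝ} (hB : 0 ≤ B) (v : Fin p → Fin (k + 1) → Fin n) :
    0 ≤ stepWeight σ B v := by
  unfold stepWeight
  split_ifs <;> positivity

open Classical in
/-- The contribution to the moment bound of the walks with a given pattern. -/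
lemma sum_hasPattern_le (π : Fin p × Fin k → Fin p × Fin k) {x y : Fin n → ℝ} {a b σ B : ℝ}
    (hk : 0 < k) (hp : Even p)
    (hx0 : ∀ i, 0 ≤ x i) (hy0 : ∀ i, 0 ≤ y i)
    (hx : ∑ i, x i ^ 2 ≤ 1) (hy : ∑ i, y i ^ 2 ≤ 1) (hxa : ∀ i, x i ≤ a) (hyb : ∀ i, y i ≤ b)
    (hb : 0 < b) (hba : b ≤ a) (ha : a ≤ 1) (hnb : 1 ≤ n * b ^ 2)
    (hσ : 0 ≤ σ) (hB : 0 ≤ B) (hBσ : B ≤ σ * √n) :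
    ∑ v : Fin p → Fin (k + 1) → Fin n with HasPattern π v,
      (∏ c, x (v c 0) * y (v c (Fin.last k))) * stepWeight σ B v ≤
      max ((σ * √n) ^ k / √n) (B ^ k * (a * b)) ^ p := by
  have hT : 0 ≤ max ((σ * √n) ^ k / √n) (B ^ k * (a * b)) ^ p :=
    pow_nonneg (le_max_of_le_left (by positivity)) p
  by_cases hex : ∃ v : Fin p → Fin (k + 1) → Fin n, HasPattern π v ∧ ∀ e, Even (stepCount v e)
  swap
  · refine le_trans (le_of_eq (Finset.sum_eq_zero fun v hv => ?_)) hT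
    rw [Finset.mem_filter] at hv
    rw [stepWeight, if_neg fun h => hex ⟨v, hv.2, h⟩, mul_zero]
  obtain ⟨v₀, hv₀, heven₀⟩ := hex
  let W := WalkSystem.ofPattern π
  let _ : Fintype (Quot (patternRel π)) := Fintype.ofFinite _
  have heven : ∀ e, Even (W.edgeCount e) := by
    rintro ⟨_, s₀, rfl⟩
    convert heven₀ (stepEdge v₀ s₀) using 1
    unfold WalkSystem.edgeCount stepCount
    congr 1
    ext s
    simp only [Finset.mem_filter, Finset.mem_univ, true_and]
    rw [← hv₀ s s₀]
    exact Subtype.ext_iff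
  have hcard : ∀ v : Fin p → Fin (k + 1) → Fin n, HasPattern π v →
      (Finset.univ.image (stepEdge v)).card = Fintype.card (Set.range π) := by
    intro v hv
    rw [← Set.toFinset_card, Set.toFinset_range]
    rcases isEmpty_or_nonempty (Fin p × Fin k) with hem | hne
    · simp [Finset.univ_eq_empty]
    have h1 : (Finset.univ.image (stepEdge v)) =
        (Finset.univ.image π).image (fun s => stepEdge v (Function.invFun π s)) := by
      rw [Finset.image_image]
      refine Finset.image_congr fun s _ => ?_
      exact ((hv _ _).1 (Function.invFun_eq (f := π) ⟨s, rfl⟩)).symm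
    rw [h1, Finset.card_image_of_injOn]
    intro s hs s' hs' h
    simp only [Finset.coe_image, Finset.coe_univ, Set.image_univ] at hs hs'
    have := (hv _ _).2 h
    rwa [Function.invFun_eq (f := π) hs, Function.invFun_eq (f := π) hs'] at this
  have hmain := W.moment_weight_le (ι := Fin n) (x := x) (y := y) (a := a) (b := b) (σ := σ)
    (B := B) hk heven (by simpa using hp) hx0 hy0 hx hy hxa hyb hb hba ha (by simpa using hnb)
    hσ hB (by simpa using hBσ)
  simp only [Fintype.card_fin] at hmain
  refine le_trans ?_ hmain
  set F : (Fin p → Fin (k + 1) → Fin n) → ℝ := fun v =>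
    (∏ c, x (v c 0) * y (v c (Fin.last k))) *
      ((σ ^ 2) ^ Fintype.card (Set.range π) * B ^ (p * k - 2 * Fintype.card (Set.range π)))
    with hF
  have hF0 : ∀ v, 0 ≤ F v := fun v =>
    mul_nonneg (Finset.prod_nonneg fun c _ => mul_nonneg (hx0 _) (hy0 _)) (by positivity)
  set Λ : (Quot (patternRel π) → Fin n) → Fin p → Fin (k + 1) → Fin n :=
    fun u a j => u (Quot.mk _ (a, j)) with hΛ
  calc ∑ v : Fin p → Fin (k + 1) → Fin n with HasPattern π v,
        (∏ c, x (v c 0) * y (v c (Fin.last k))) * stepWeight σ B v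
      ≤ ∑ v : Fin p → Fin (k + 1) → Fin n with HasPattern π v, F v := by
        refine Finset.sum_le_sum fun v hv => ?_
        rw [Finset.mem_filter] at hv
        refine mul_le_mul_of_nonneg_left ?_
          (Finset.prod_nonneg fun c _ => mul_nonneg (hx0 _) (hy0 _))
        unfold stepWeight
        rw [hcard v hv.2]
        split_ifs
        · exact le_rfl
        · positivity
    _ ≤ ∑ v ∈ Finset.univ.image Λ, F v := by
        refine Finset.sum_le_sum_of_subset_of_nonneg ?_ fun v _ _ => hF0 v
        intro v hv
        rw [Finset.mem_filter] at hv
        obtain ⟨u, hu⟩ := hv.2.exists_lift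
        exact Finset.mem_image.2 ⟨u, Finset.mem_univ u, hu.symm⟩
    _ ≤ ∑ u, F (Λ u) := Finset.sum_image_le_of_nonneg fun v _ => hF0 v
    _ = _ := by
        rw [Finset.mul_sum]
        refine Finset.sum_congr rfl fun u _ => ?_
        exact mul_comm _ _

open Classical in
/-- The sum over all families of walks that bounds the moment. -/
lemma sum_stepWeight_le {x y : Fin n → ℝ} {a b σ B : ℝ}
    (hk : 0 < k) (hp : Even p)
    (hx0 : ∀ i, 0 ≤ x i) (hy0 : ∀ i, 0 ≤ y i)
    (hx : ∑ i, x i ^ 2 ≤ 1) (hy : ∑ i, y i ^ 2 ≤ 1) (hxa : ∀ i, x i ≤ a) (hyb : ∀ i, y i ≤ b)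
    (hb : 0 < b) (hba : b ≤ a) (ha : a ≤ 1) (hnb : 1 ≤ n * b ^ 2)
    (hσ : 0 ≤ σ) (hB : 0 ≤ B) (hBσ : B ≤ σ * √n) :
    ∑ v : Fin p → Fin (k + 1) → Fin n,
      (∏ c, x (v c 0) * y (v c (Fin.last k))) * stepWeight σ B v ≤
      ((p * k : ℕ) : ℝ) ^ (p * k) * max ((σ * √n) ^ k / √n) (B ^ k * (a * b)) ^ p := by
  set F : (Fin p → Fin (k + 1) → Fin n) → ℝ := fun v =>
    (∏ c, x (v c 0) * y (v c (Fin.last k))) * stepWeight σ B v with hF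
  have hF0 : ∀ v, 0 ≤ F v := fun v =>
    mul_nonneg (Finset.prod_nonneg fun c _ => mul_nonneg (hx0 _) (hy0 _))
      (stepWeight_nonneg hB v)
  calc ∑ v, F v ≤ ∑ v, ∑ π : Fin p × Fin k → Fin p × Fin k, if HasPattern π v then F v else 0 := by
        refine Finset.sum_le_sum fun v _ => ?_
        obtain ⟨π, hπ⟩ := exists_hasPattern v
        refine le_trans ?_ (Finset.single_le_sum
          (f := fun π => if HasPattern π v then F v else 0) (fun π _ => ?_) (Finset.mem_univ π))
        · simp [hπ]
        · split_ifs
          exacts [hF0 v, le_rfl]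
    _ = ∑ π : Fin p × Fin k → Fin p × Fin k,
          ∑ v : Fin p → Fin (k + 1) → Fin n with HasPattern π v, F v := by
        rw [Finset.sum_comm]
        simp only [Finset.sum_filter]
    _ ≤ ∑ π : Fin p × Fin k → Fin p × Fin k,
          max ((σ * √n) ^ k / √n) (B ^ k * (a * b)) ^ p :=
        Finset.sum_le_sum fun π _ =>
          sum_hasPattern_le π hk hp hx0 hy0 hx hy hxa hyb hb hba ha hnb hσ hB hBσ
    _ = _ := by
        rw [Finset.sum_const, Finset.card_univ, Fintype.card_fun, nsmul_eq_mul]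
        simp

end Pattern

namespace IsNoiseMatrix

set_option linter.unusedSectionVars false

variable {Ω : Type*} [MeasurableSpace Ω] {P : Measure Ω} [IsProbabilityMeasure P] {n : ℕ}
  {H : Ω → Matrix (Fin n) (Fin n) ℝ} {σ B : ℝ}

lemma transpose (h : IsNoiseMatrix P H σ B) : IsNoiseMatrix P (fun ω => (H ω)ᵀ) σ B where
  measurable i j := h.measurable j i
  indep := h.indep.precomp (g := Prod.swap) Prod.swap_injective
  mean_zero i j := h.mean_zero j i
  variance_le i j := h.variance_le j i
  bounded i j := h.bounded j i
  symm_about_zero i j := h.symm_about_zero j i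

lemma ae_bounded (h : IsNoiseMatrix P H σ B) : ∀ᵐ ω ∂P, ∀ i j, |H ω i j| ≤ B := by
  rw [ae_all_iff]
  intro i
  rw [ae_all_iff]
  exact h.bounded i

lemma integrable_pow (h : IsNoiseMatrix P H σ B) (i j : Fin n) (m : ℕ) :
    Integrable (fun ω => H ω i j ^ m) P := by
  refine Integrable.of_bound ((h.measurable i j).pow_const m).aestronglyMeasurable (B ^ m) ?_
  filter_upwards [h.bounded i j] with ω hω
  rw [Real.norm_eq_abs, abs_pow]
  exact pow_le_pow_left₀ (abs_nonneg _) hω m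

lemma integral_pow_odd (h : IsNoiseMatrix P H σ B) (i j : Fin n) {m : ℕ} (hm : Odd m) :
    ∫ ω, H ω i j ^ m ∂P = 0 := by
  have hf : AEStronglyMeasurable (fun x : ℝ => x ^ m) (P.map fun ω => H ω i j) :=
    (measurable_id.pow_const m).aestronglyMeasurable
  have hf' : AEStronglyMeasurable (fun x : ℝ => x ^ m) (P.map fun ω => -H ω i j) :=
    (measurable_id.pow_const m).aestronglyMeasurable
  have h1 := integral_map (h.measurable i j).aemeasurable hf
  have h2 := integral_map (h.measurable i j).neg.aemeasurable hf'
  rw [h.symm_about_zero i j] at h1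
  have h3 := h1.symm.trans h2
  simp only [Pi.neg_apply, hm.neg_pow, integral_neg] at h3
  linarith

lemma abs_integral_pow_le (h : IsNoiseMatrix P H σ B) (i j : Fin n) {m : ℕ} (hm : 2 ≤ m)
    (heven : Even m) : |∫ ω, H ω i j ^ m ∂P| ≤ σ ^ 2 * B ^ (m - 2) := by
  obtain ⟨l, rfl⟩ := Nat.exists_eq_add_of_le' hm
  have hvar : ∫ ω, H ω i j ^ 2 ∂P ≤ σ ^ 2 := by
    have := h.variance_le i j
    rwa [variance_of_integral_eq_zero (h.measurable i j).aemeasurable (h.mean_zero i j)] at this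
  have hB : 0 ≤ B := by
    obtain ⟨ω, hω⟩ := (h.bounded i j).exists
    exact (abs_nonneg _).trans hω
  rw [Nat.add_sub_cancel, abs_of_nonneg (integral_nonneg fun ω => heven.pow_nonneg _)]
  calc ∫ ω, H ω i j ^ (l + 2) ∂P ≤ ∫ ω, B ^ l * H ω i j ^ 2 ∂P := by
        refine integral_mono_ae (h.integrable_pow i j _) ((h.integrable_pow i j 2).const_mul _) ?_
        filter_upwards [h.bounded i j] with ω hω
        have h1 : H ω i j ^ l ≤ B ^ l := (le_abs_self _).trans (by
          rw [abs_pow]; exact pow_le_pow_left₀ (abs_nonneg _) hω l)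
        simp only [pow_add]
        exact mul_le_mul_of_nonneg_right h1 (sq_nonneg _)
    _ = B ^ l * ∫ ω, H ω i j ^ 2 ∂P := integral_const_mul _ _
    _ ≤ B ^ l * σ ^ 2 := by gcongr
    _ = _ := mul_comm _ _

variable {p k : ℕ}

lemma integrable_prod_step (h : IsNoiseMatrix P H σ B) (v : Fin p → Fin (k + 1) → Fin n) :
    Integrable (fun ω => ∏ s, H ω (stepEdge v s).1 (stepEdge v s).2) P := by
  refine Integrable.of_bound (Finset.measurable_prod _ fun s _ =>
    h.measurable _ _).aestronglyMeasurable (∏ _s : Fin p × Fin k, B) ?_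
  filter_upwards [h.ae_bounded] with ω hω
  rw [Real.norm_eq_abs, Finset.abs_prod]
  exact Finset.prod_le_prod (fun _ _ => abs_nonneg _) fun s _ => hω _ _

lemma sum_stepCount (v : Fin p → Fin (k + 1) → Fin n) :
    ∑ e ∈ Finset.univ.image (stepEdge v), stepCount v e = p * k := by
  have := Finset.card_eq_sum_card_image (stepEdge v) Finset.univ
  simpa [stepCount] using this.symm

lemma abs_integral_prod_step_le (h : IsNoiseMatrix P H σ B)
    (v : Fin p → Fin (k + 1) → Fin n) :
    |∫ ω, ∏ s, H ω (stepEdge v s).1 (stepEdge v s).2 ∂P| ≤ stepWeight σ B v := by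
  have h1 : ∀ ω, ∏ s, H ω (stepEdge v s).1 (stepEdge v s).2 =
      ∏ e : Fin n × Fin n, H ω e.1 e.2 ^ stepCount v e := by
    intro ω
    rw [← Finset.prod_fiberwise' Finset.univ (stepEdge v) (fun e => H ω e.1 e.2)]
    simp [stepCount]
  have h2 : ∫ ω, ∏ s, H ω (stepEdge v s).1 (stepEdge v s).2 ∂P =
      ∏ e : Fin n × Fin n, ∫ ω, H ω e.1 e.2 ^ stepCount v e ∂P := by
    simp only [h1]
    exact h.indep.integral_fun_prod_comp (f := fun e (x : ℝ) => x ^ stepCount v e)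
      (fun e => (h.measurable e.1 e.2).aemeasurable)
      (fun e => (measurable_id.pow_const _).aestronglyMeasurable)
  rw [h2, Finset.abs_prod, stepWeight]
  split_ifs with heven
  · set I := Finset.univ.image (stepEdge v) with hI
    have hmem : ∀ e ∈ I, 2 ≤ stepCount v e := by
      intro e he
      obtain ⟨s, -, rfl⟩ := Finset.mem_image.1 he
      have : 0 < stepCount v (stepEdge v s) := Finset.card_pos.2 ⟨s, by simp⟩
      obtain ⟨c, hc⟩ := heven (stepEdge v s)
      omega
    have hsum : ∑ e ∈ I, (stepCount v e - 2) = p * k - 2 * I.card := by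
      rw [Finset.sum_tsub_distrib _ hmem, sum_stepCount, Finset.sum_const, smul_eq_mul, mul_comm 2]
    calc ∏ e : Fin n × Fin n, |∫ ω, H ω e.1 e.2 ^ stepCount v e ∂P|
        = ∏ e ∈ I, |∫ ω, H ω e.1 e.2 ^ stepCount v e ∂P| := by
          refine (Finset.prod_subset (Finset.subset_univ I) fun e _ he => ?_).symm
          have : stepCount v e = 0 := by
            refine Finset.card_eq_zero.2 (Finset.filter_eq_empty_iff.2 fun s _ hs => he ?_)
            exact Finset.mem_image.2 ⟨s, Finset.mem_univ s, hs⟩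
          simp [this]
      _ ≤ ∏ e ∈ I, σ ^ 2 * B ^ (stepCount v e - 2) :=
          Finset.prod_le_prod (fun e _ => abs_nonneg _) fun e he =>
            h.abs_integral_pow_le _ _ (hmem e he) (heven e)
      _ = _ := by
          rw [Finset.prod_mul_distrib, Finset.prod_const, Finset.prod_pow_eq_pow_sum, hsum]
  · obtain ⟨e, he⟩ := not_forall.1 heven
    refine le_of_eq (Finset.prod_eq_zero (Finset.mem_univ e) ?_)
    rw [h.integral_pow_odd _ _ (Nat.not_even_iff_odd.1 he), abs_zero]

lemma integrable_dotProduct_pow (h : IsNoiseMatrix P H σ B) (p k : ℕ) (x y : Fin n → ℝ) :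
    Integrable (fun ω => (x ⬝ᵥ (H ω ^ k *ᵥ y)) ^ p) P := by
  simp only [pow_dotProduct_pow_mulVec]
  exact integrable_finsetSum _ fun v _ => (h.integrable_prod_step v).const_mul _

/-- The moment bound, for a vector `x` whose maximum norm is at least that of `y`. -/
lemma integral_dotProduct_pow_le_of_le (h : IsNoiseMatrix P H σ B) {x y : Fin n → ℝ} {a b : ℝ}
    (hk : 0 < k) (hp : Even p)
    (hx : ∑ i, x i ^ 2 ≤ 1) (hy : ∑ i, y i ^ 2 ≤ 1) (hxa : ∀ i, |x i| ≤ a) (hyb : ∀ i, |y i| ≤ b)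
    (hb : 0 < b) (hba : b ≤ a) (ha : a ≤ 1) (hnb : 1 ≤ n * b ^ 2)
    (hσ : 0 ≤ σ) (hB : 0 ≤ B) (hBσ : B ≤ σ * √n) :
    ∫ ω, (x ⬝ᵥ (H ω ^ k *ᵥ y)) ^ p ∂P ≤
      ((p * k : ℕ) : ℝ) ^ (p * k) * max ((σ * √n) ^ k / √n) (B ^ k * (a * b)) ^ p := by
  refine le_trans ?_ (sum_stepWeight_le (x := fun i => |x i|) (y := fun i => |y i|) hk hp
    (fun _ => abs_nonneg _) (fun _ => abs_nonneg _) (by simpa using hx) (by simpa using hy)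
    hxa hyb hb hba ha hnb hσ hB hBσ)
  simp only [pow_dotProduct_pow_mulVec]
  rw [integral_finsetSum _ fun v _ => (h.integrable_prod_step v).const_mul _]
  refine Finset.sum_le_sum fun v _ => ?_
  rw [integral_const_mul]
  refine (le_abs_self _).trans ?_
  rw [abs_mul, Finset.abs_prod]
  simp only [abs_mul]
  exact mul_le_mul_of_nonneg_left (h.abs_integral_prod_step_le v)
    (Finset.prod_nonneg fun c _ => by positivity)

/-- The moment bound for `xᵀ Hᵏ y`. -/
lemma integral_dotProduct_pow_le (h : IsNoiseMatrix P H σ B) {x y : Fin n → ℝ} {a b : ℝ}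
    (hk : 0 < k) (hp : Even p)
    (hx : ∑ i, x i ^ 2 ≤ 1) (hy : ∑ i, y i ^ 2 ≤ 1) (hxa : ∀ i, |x i| ≤ a) (hyb : ∀ i, |y i| ≤ b)
    (ha0 : 0 < a) (hb0 : 0 < b) (ha : a ≤ 1) (hb : b ≤ 1)
    (hna : 1 ≤ n * a ^ 2) (hnb : 1 ≤ n * b ^ 2)
    (hσ : 0 ≤ σ) (hB : 0 ≤ B) (hBσ : B ≤ σ * √n) :
    ∫ ω, (x ⬝ᵥ (H ω ^ k *ᵥ y)) ^ p ∂P ≤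
      ((p * k : ℕ) : ℝ) ^ (p * k) * max ((σ * √n) ^ k / √n) (B ^ k * (a * b)) ^ p := by
  rcases le_total b a with hba | hab
  · exact h.integral_dotProduct_pow_le_of_le hk hp hx hy hxa hyb hb0 hba ha hnb hσ hB hBσ
  · have := h.transpose.integral_dotProduct_pow_le_of_le (p := p) hk hp hy hx hyb hxa ha0 hab hb
      hna hσ hB hBσ
    rw [mul_comm b a] at this
    refine le_trans (le_of_eq ?_) this
    refine integral_congr_ae (Eventually.of_forall fun ω => ?_)
    simp only
    rw [← transpose_pow, mulVec_transpose, dotProduct_comm y, ← dotProduct_mulVec]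

end IsNoiseMatrix

/-- A tail bound from the bound `(L ^ k * T) ^ p` for the `p`-th moment, where `L = p * k`. -/
lemma measureReal_lt_abs_sub_integral_le {Ω : Type*} [MeasurableSpace Ω] {P : Measure Ω}
    [IsProbabilityMeasure P] {Z : Ω → ℝ} {p k : ℕ} {T : ℝ} (hp : Even p) (hp0 : 0 < p)
    (hk : 0 < k) (hT : 0 ≤ T) (hint : Integrable Z P) (hintp : Integrable (fun ω => Z ω ^ p) P)
    (hmom : ∫ ω, Z ω ^ p ∂P ≤ ((p * k : ℕ) : ℝ) ^ (p * k) * T ^ p) :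
    P.real {ω | 2 * ((3 * (p * k : ℕ) : ℝ) ^ k * T) < |Z ω - ∫ ω', Z ω' ∂P|} ≤
      Real.exp (-(p * k : ℕ)) := by
  set L : ℝ := ((p * k : ℕ) : ℝ) with hL
  have hL0 : 0 < L := by rw [hL]; exact_mod_cast Nat.mul_pos hp0 hk
  have hmom' : ∫ ω, Z ω ^ p ∂P ≤ (L ^ k * T) ^ p := by
    rwa [mul_pow, ← pow_mul, mul_comm k p]
  have hLτ : L ^ k * T ≤ (3 * L) ^ k * T := by
    gcongr
    linarith
  have hmean : |∫ ω, Z ω ∂P| ≤ L ^ k * T := by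
    have h1 := (hp.convexOn_pow (𝕜 := ℝ)).map_integral_le (μ := P) (f := Z)
      (continuous_pow p).continuousOn isClosed_univ (Eventually.of_forall fun _ => Set.mem_univ _)
      hint hintp
    change (∫ ω, Z ω ∂P) ^ p ≤ ∫ ω, Z ω ^ p ∂P at h1
    rw [← hp.pow_abs] at h1
    exact le_of_pow_le_pow_left₀ hp0.ne' (by positivity) (h1.trans hmom')
  have hsub : {ω | 2 * ((3 * L) ^ k * T) < |Z ω - ∫ ω', Z ω' ∂P|} ⊆
      {ω | (3 * L) ^ k * T < |Z ω|} := by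
    intro ω hω
    simp only [Set.mem_ofPred_eq] at hω ⊢
    have := abs_sub (Z ω) (∫ ω', Z ω' ∂P)
    linarith
  refine (measureReal_mono hsub).trans ?_
  have hnn : 0 ≤ᵐ[P] fun ω => Z ω ^ p := Eventually.of_forall fun ω => hp.pow_nonneg _
  rcases hT.eq_or_lt with h0 | hT0
  · have h1 : ∫ ω, Z ω ^ p ∂P = 0 := by
      refine le_antisymm ?_ (integral_nonneg_of_ae hnn)
      simpa [← h0, hp0.ne'] using hmom'
    have h2 := (integral_eq_zero_iff_of_nonneg_ae hnn hintp).1 h1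
    have h3 : P {ω | (3 * L) ^ k * T < |Z ω|} = 0 := by
      rw [measure_eq_zero_iff_ae_notMem]
      filter_upwards [h2] with ω hω
      have : Z ω = 0 := by simpa [hp0.ne'] using hω
      simp [this, ← h0]
    rw [measureReal_def, h3]
    simpa using (Real.exp_pos _).le
  · have h1 := mul_meas_ge_le_integral_of_nonneg hnn hintp (((3 * L) ^ k * T) ^ p)
    have h2 : P.real {ω | (3 * L) ^ k * T < |Z ω|} ≤
        P.real {ω | ((3 * L) ^ k * T) ^ p ≤ Z ω ^ p} := by
      refine measureReal_mono fun ω hω => ?_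
      simp only [Set.mem_ofPred_eq] at hω ⊢
      rw [← hp.pow_abs (Z ω)]
      exact pow_le_pow_left₀ (by positivity) hω.le p
    refine h2.trans ?_
    have h3 : ((3 * L) ^ k * T) ^ p = 3 ^ (p * k) * (L ^ k * T) ^ p := by
      rw [mul_pow 3 L, mul_assoc, mul_pow (3 ^ k), ← pow_mul, mul_comm k p]
    have h4 : 0 < (L ^ k * T) ^ p := by positivity
    rw [h3] at h1
    have h5 : 3 ^ (p * k) * P.real {ω | ((3 * L) ^ k * T) ^ p ≤ Z ω ^ p} ≤ 1 := by
      rw [h3]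
      have := h1.trans hmom'
      rw [mul_right_comm] at this
      exact (mul_le_iff_le_one_left h4).1 this
    have h6 : Real.exp (p * k : ℕ) ≤ 3 ^ (p * k) := by
      rw [← mul_one ((p * k : ℕ) : ℝ), Real.exp_nat_mul]
      exact pow_le_pow_left₀ (Real.exp_pos _).le (by linarith [Real.exp_one_lt_d9]) _
    rw [Real.exp_neg, ← one_div, le_div_iff₀ (Real.exp_pos _)]
    calc _ ≤ P.real {ω | ((3 * L) ^ k * T) ^ p ≤ Z ω ^ p} * 3 ^ (p * k) := by gcongr
      _ ≤ 1 := by rwa [mul_comm]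

section SupNorm

variable {n : ℕ} {x : EuclideanSpace ℝ (Fin n)}

lemma abs_le_supNorm (x : EuclideanSpace ℝ (Fin n)) (i : Fin n) : |x i| ≤ supNorm x :=
  le_ciSup (f := fun i => |x i|) (Set.finite_range _).bddAbove i

lemma sum_sq_eq_one (hx : ‖x‖ = 1) : ∑ i, x i ^ 2 = 1 := by
  rw [← EuclideanSpace.real_norm_sq_eq, hx, one_pow]

lemma one_le_mul_supNorm_sq (hx : ‖x‖ = 1) : 1 ≤ n * supNorm x ^ 2 := by
  rw [← sum_sq_eq_one hx]
  calc ∑ i, x i ^ 2 ≤ ∑ _i : Fin n, supNorm x ^ 2 := by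
        refine Finset.sum_le_sum fun i _ => ?_
        rw [← sq_abs]
        exact pow_le_pow_left₀ (abs_nonneg _) (abs_le_supNorm x i) 2
    _ = _ := by simp

lemma supNorm_pos (hx : ‖x‖ = 1) : 0 < supNorm x := by
  have h1 : 0 ≤ supNorm x := Real.iSup_nonneg fun i => abs_nonneg _
  refine h1.lt_of_ne fun h => ?_
  have := one_le_mul_supNorm_sq hx
  rw [← h] at this
  norm_num at this

lemma supNorm_le_one (hx : ‖x‖ = 1) : supNorm x ≤ 1 := by
  refine Real.iSup_le (fun i => ?_) zero_le_one
  rw [← abs_one, ← sq_le_sq, one_pow, ← sum_sq_eq_one hx]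
  exact Finset.single_le_sum (f := fun i => x i ^ 2) (fun i _ => sq_nonneg _) (Finset.mem_univ i)

end SupNorm

/-- An even exponent `p` for which `p * k` is of the order of `l`. -/
lemma exists_even_mul_bounds {l : ℝ} (hl : 0 < l) {k : ℕ} (hk : 0 < k) (hkl : (k : ℝ) ≤ 20 * l) :
    ∃ p : ℕ, Even p ∧ 0 < p ∧ 41 * l ≤ (p * k : ℕ) ∧ ((p * k : ℕ) : ℝ) ≤ 81 * l := by
  have hk0 : (0 : ℝ) < k := by exact_mod_cast hk
  have hpos : 0 < 41 * l / (2 * k) := by positivity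
  refine ⟨2 * ⌈41 * l / (2 * k)⌉₊, even_two_mul _, by
    have := Nat.ceil_pos.2 hpos
    omega, ?_, ?_⟩
  · have := Nat.le_ceil (41 * l / (2 * k))
    rw [div_le_iff₀ (by positivity)] at this
    push_cast
    linarith
  · have := Nat.ceil_lt_add_one hpos.le
    have h2 : (⌈41 * l / (2 * k)⌉₊ : ℝ) * (2 * k) < (41 * l / (2 * k) + 1) * (2 * k) := by gcongr
    rw [add_mul, div_mul_cancel₀ _ (by positivity)] at h2
    push_cast
    linarith

lemma pow_mul_max_le {σ B l θ n : ℝ} (hl : 1 ≤ l) (hn : 0 < n)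
    (hB : 0 ≤ B) (hθ : 0 ≤ θ) (k : ℕ) :
    l ^ k * max ((σ * √n) ^ k / √n) (B ^ k * θ) ≤
      max (√((σ ^ 2 * n * l ^ 3) ^ k / n)) ((B * l ^ 3) ^ k * θ) := by
  have hl0 : 0 < l := by linarith
  rw [mul_max_of_nonneg _ _ (by positivity)]
  refine max_le_max ?_ ?_
  · refine Real.le_sqrt_of_sq_le ?_
    have h1 : (l ^ k * ((σ * √n) ^ k / √n)) ^ 2 = (σ ^ 2 * n * l ^ 2) ^ k / n := by
      rw [mul_pow, div_pow, Real.sq_sqrt hn.le, ← pow_mul, ← pow_mul, mul_comm k 2, pow_mul,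
        pow_mul, mul_pow σ, Real.sq_sqrt hn.le, mul_pow (σ ^ 2 * n)]
      ring
    rw [h1]
    have h2 : l ^ 2 ≤ l ^ 3 := pow_le_pow_right₀ hl (by norm_num)
    gcongr
  · rw [← mul_assoc, ← mul_pow]
    have h2 : l * B ≤ B * l ^ 3 := by
      rw [mul_comm]
      exact mul_le_mul_of_nonneg_left (le_self_pow₀ hl (by norm_num)) hB
    gcongr

/-- The tail bound for a single power. -/
lemma IsNoiseMatrix.measureReal_bilin_le {Ω : Type*} [MeasurableSpace Ω] {P : Measure Ω}
    [IsProbabilityMeasure P] {n : ℕ} {H : Ω → Matrix (Fin n) (Fin n) ℝ} {σ B : ℝ}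
    (h : IsNoiseMatrix P H σ B) {x y : EuclideanSpace ℝ (Fin n)} (hx : ‖x‖ = 1) (hy : ‖y‖ = 1)
    (hσ : 0 ≤ σ) (hB : 0 ≤ B) (hBσ : B ≤ σ * √n) (hn : 0 < n) (hlog : 1 ≤ Real.log n)
    {k : ℕ} (hk : 2 ≤ k) (hkn : (k : ℝ) ≤ 20 * Real.log n) :
    P.real {ω | 2 * (243 ^ k * Real.log n ^ 2 *
        max (√((σ ^ 2 * n * Real.log n ^ 3) ^ k / n))
          ((B * Real.log n ^ 3) ^ k * supNorm x * supNorm y)) <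
        |bilin (H ω ^ k) x y - ∫ ω', bilin (H ω' ^ k) x y ∂P|} ≤ ((n : ℝ) ^ 41)⁻¹ := by
  have hn0 : (0 : ℝ) < n := by exact_mod_cast hn
  have hk0 : 0 < k := by omega
  obtain ⟨p, hp, hp0, hlow, hup⟩ := exists_even_mul_bounds (zero_lt_one.trans_le hlog) hk0 hkn
  set T := max ((σ * √n) ^ k / √n) (B ^ k * (supNorm x * supNorm y)) with hTdef
  have hT : 0 ≤ T := le_max_of_le_left (by positivity)
  have hmom := h.integral_dotProduct_pow_le (p := p) (x := x.ofLp) (y := y.ofLp) hk0 hp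
    (sum_sq_eq_one hx).le (sum_sq_eq_one hy).le (abs_le_supNorm x) (abs_le_supNorm y)
    (supNorm_pos hx) (supNorm_pos hy) (supNorm_le_one hx) (supNorm_le_one hy)
    (one_le_mul_supNorm_sq hx) (one_le_mul_supNorm_sq hy) hσ hB hBσ
  have hint : Integrable (fun ω => bilin (H ω ^ k) x y) P := by
    simpa only [bilin, pow_one] using h.integrable_dotProduct_pow 1 k x.ofLp y.ofLp
  have htail := measureReal_lt_abs_sub_integral_le (Z := fun ω => bilin (H ω ^ k) x y) hp hp0 hk0
    hT hint (h.integrable_dotProduct_pow p k x.ofLp y.ofLp) hmom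
  have hbound : (3 * (p * k : ℕ) : ℝ) ^ k * T ≤ 243 ^ k * Real.log n ^ 2 *
      max (√((σ ^ 2 * n * Real.log n ^ 3) ^ k / n))
        ((B * Real.log n ^ 3) ^ k * supNorm x * supNorm y) := by
    have hθ : 0 ≤ supNorm x * supNorm y := (mul_pos (supNorm_pos hx) (supNorm_pos hy)).le
    have h1 := pow_mul_max_le (σ := σ) hlog hn0 hB hθ k
    rw [mul_assoc ((B * Real.log n ^ 3) ^ k)]
    set M := max (√((σ ^ 2 * n * Real.log n ^ 3) ^ k / n))
      ((B * Real.log n ^ 3) ^ k * (supNorm x * supNorm y))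
    have hM : 0 ≤ M := le_max_of_le_left (Real.sqrt_nonneg _)
    calc (3 * (p * k : ℕ) : ℝ) ^ k * T ≤ (243 * Real.log n) ^ k * T := by
          have h2 : (3 * (p * k : ℕ) : ℝ) ≤ 243 * Real.log n := by linarith
          gcongr
      _ = 243 ^ k * (Real.log n ^ k * T) := by rw [mul_pow, mul_assoc]
      _ ≤ 243 ^ k * M := by gcongr
      _ ≤ 243 ^ k * Real.log n ^ 2 * M := by
          gcongr
          exact le_mul_of_one_le_right (by positivity) (one_le_pow₀ hlog)
  refine (measureReal_mono fun ω hω => ?_).trans (htail.trans ?_)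
  · exact (mul_le_mul_of_nonneg_left hbound zero_le_two).trans_lt hω
  · calc Real.exp (-(p * k : ℕ)) ≤ Real.exp (-((41 : ℕ) * Real.log n)) :=
          Real.exp_le_exp.2 (neg_le_neg (by exact_mod_cast hlow))
      _ = ((n : ℝ) ^ 41)⁻¹ := by rw [Real.exp_neg, Real.exp_nat_mul, Real.exp_log hn0]

theorem theorem3 :
    ∃ c₂ C K α : ℝ, 0 < c₂ ∧ 0 < C ∧ 0 < K ∧
      ∀ σ B : ℕ → ℝ, (∀ n, 0 ≤ σ n) → (∀ n, 0 ≤ B n) →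
        B =o[atTop] (fun n : ℕ => σ n * Real.sqrt ((n : ℝ) / Real.log (n : ℝ) ^ 3)) →
        ∃ N : ℕ, ∀ n : ℕ, N ≤ n →
          ∀ (Ω : Type*) [MeasurableSpace Ω] (P : Measure Ω) [IsProbabilityMeasure P]
            (H : Ω → Matrix (Fin n) (Fin n) ℝ), IsNoiseMatrix P H (σ n) (B n) →
          ∀ x y : EuclideanSpace ℝ (Fin n), ‖x‖ = 1 → ‖y‖ = 1 →
            1 - K * Real.log (n : ℝ) ^ α / (n : ℝ) ^ 40 ≤
              P.real {ω | ∀ k : ℕ, 2 ≤ k → (k : ℝ) ≤ 20 * Real.log (n : ℝ) →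
                |bilin (H ω ^ k) x y - ∫ ω', bilin (H ω' ^ k) x y ∂P| ≤
                  C * (c₂ ^ k * Real.log (n : ℝ) ^ 2 *
                    max (Real.sqrt ((σ n ^ 2 * n * Real.log (n : ℝ) ^ 3) ^ k / n))
                      ((B n * Real.log (n : ℝ) ^ 3) ^ k * supNorm x * supNorm y))} := by
  refine ⟨243, 2, 1, 0, by norm_num, by norm_num, by norm_num, fun σ B hσ hB hBσ => ?_⟩
  have hlog_large : ∀ᶠ n : ℕ in atTop, 1 ≤ Real.log n :=
    (Real.tendsto_log_atTop.comp tendsto_natCast_atTop_atTop).eventually_ge_atTop 1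
  have hlog_small : ∀ᶠ n : ℕ in atTop, 20 * Real.log n ≤ n := by
    have := (Real.isLittleO_log_id_atTop.comp_tendsto tendsto_natCast_atTop_atTop).bound
      (show (0 : ℝ) < 1 / 20 by norm_num)
    filter_upwards [this, hlog_large] with n hn hn'
    simp only [Function.comp, id, Real.norm_eq_abs, Nat.abs_cast] at hn
    rw [abs_of_nonneg (by linarith)] at hn
    linarith
  obtain ⟨N, hN⟩ := eventually_atTop.1
    ((hBσ.bound zero_lt_one).and (hlog_large.and (hlog_small.and (eventually_gt_atTop 0))))
  refine ⟨N, fun n hn Ω _ P _ H h x y hx hy => ?_⟩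
  obtain ⟨hb, hlog, hlog', hn0⟩ := hN n hn
  have hn1 : (0 : ℝ) < n := by exact_mod_cast hn0
  have hBn : B n ≤ σ n * √n := by
    rw [one_mul, Real.norm_of_nonneg (hB n),
      Real.norm_of_nonneg (mul_nonneg (hσ n) (Real.sqrt_nonneg _))] at hb
    refine hb.trans (mul_le_mul_of_nonneg_left (Real.sqrt_le_sqrt ?_) (hσ n))
    exact div_le_self hn1.le (one_le_pow₀ hlog)
  set bad : ℕ → Set Ω := fun k => {ω | 2 * (243 ^ k * Real.log n ^ 2 *
        max (√((σ n ^ 2 * n * Real.log n ^ 3) ^ k / n))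
          ((B n * Real.log n ^ 3) ^ k * supNorm x * supNorm y)) <
        |bilin (H ω ^ k) x y - ∫ ω', bilin (H ω' ^ k) x y ∂P|} with hbad
  set good := {ω | ∀ k : ℕ, 2 ≤ k → (k : ℝ) ≤ 20 * Real.log (n : ℝ) →
                |bilin (H ω ^ k) x y - ∫ ω', bilin (H ω' ^ k) x y ∂P| ≤
                  2 * (243 ^ k * Real.log (n : ℝ) ^ 2 *
                    max (Real.sqrt ((σ n ^ 2 * n * Real.log (n : ℝ) ^ 3) ^ k / n))
                      ((B n * Real.log (n : ℝ) ^ 3) ^ k * supNorm x * supNorm y))} with hgood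
  set I := Finset.Icc 2 ⌊20 * Real.log (n : ℝ)⌋₊ with hI
  have hcover : Set.univ ⊆ good ∪ ⋃ k ∈ I, bad k := by
    intro ω _
    by_cases hω : ω ∈ good
    · exact Or.inl hω
    · right
      simp only [hgood, Set.mem_ofPred_eq, not_forall, not_le] at hω
      obtain ⟨k, hk2, hk, hlt⟩ := hω
      simp only [Set.mem_iUnion]
      exact ⟨k, Finset.mem_Icc.2 ⟨hk2, Nat.le_floor hk⟩, hlt⟩
  have hbadle : P.real (⋃ k ∈ I, bad k) ≤ ((n : ℝ) ^ 40)⁻¹ := by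
    calc P.real (⋃ k ∈ I, bad k) ≤ ∑ k ∈ I, P.real (bad k) := measureReal_biUnion_finset_le _ _
      _ ≤ ∑ _k ∈ I, ((n : ℝ) ^ 41)⁻¹ := by
          refine Finset.sum_le_sum fun k hk => ?_
          rw [Finset.mem_Icc] at hk
          exact h.measureReal_bilin_le hx hy (hσ n) (hB n) hBn hn0 hlog hk.1
            ((Nat.le_floor_iff (by linarith)).1 hk.2)
      _ = (I.card : ℝ) * ((n : ℝ) ^ 41)⁻¹ := by simp
      _ ≤ n * ((n : ℝ) ^ 41)⁻¹ := by
          have h1 : I.card ≤ ⌊20 * Real.log (n : ℝ)⌋₊ := by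
            rw [hI, Nat.card_Icc]
            omega
          have h2 : (I.card : ℝ) ≤ ⌊20 * Real.log (n : ℝ)⌋₊ := by exact_mod_cast h1
          have h3 := h2.trans ((Nat.floor_le (by linarith)).trans hlog')
          gcongr
      _ = ((n : ℝ) ^ 40)⁻¹ := by field_simp
  have h1 := (measureReal_mono (μ := P) hcover).trans (measureReal_union_le _ _)
  rw [probReal_univ] at h1
  rw [Real.rpow_zero, mul_one, one_div]
  linarith
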